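/- **Geometric model.** Keys are $[n]$, times are $[m]$; $n,m\ge 0$. An update sequence $S=\langle(s_1,\mathrm{op}_1),\dots,(s_m,\mathrm{op}_m)\rangle$ with $s_t\in[n]$ and $\mathrm{op}_t\in\{\text{access},\text{insert},\text{delete}\}$ is viewed as the set of grid points $(s_t,t)\in[n]\times[m]$; insertions and deletions are called updates. On each key, insertions and deletions alternate, and a key is accessed only while present. A point $(x,t)$ is *valid* if $x$ is present at time $t$; the times of the insertion and of the deletion of $x$ count as valid. A key whose first update is a deletion, or which is never updated, is present from the start. The *predecessor* and *successor* of a point $(x,t)$ are the points $(x',t)$ for the nearest smaller, respectively larger, key $x'$ such that $(x',t)$ is valid; an update point is at the current *minimum* (*maximum*) if it has no predecessor (successor). An *active period* of a key runs from an insertion (or the start) to the next deletion (or the end), both inclusive. **Greedy.** Greedy processes the rows $t=1,\dots,m$ in order and builds a set of touched points. For a point $p=(x,t)$, $\mathrm{stair}(p)$ consists of $p$ and of all points $q=(y,s)$ with $s<t$ touched so far such that each of $x$ and $y$ has an active period containing $[s,t]$, and the closed axis-parallel rectangle with corners $p,q$ contains no touched point other than $p,q$, where deletion points on the row of $q$ and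 insertion points on the row of $p$ are disregarded. To touch $\mathrm{stair}(p)$ means to add to the touched set the points $(y,t)$ for all keys $y$ of points in $\mathrm{stair}(p)$. At time $t$, with $p=(s_t,t)$, Greedy touches $\mathrm{stair}(p)$ if $p$ is an access or an update at the current minimum or maximum; for any other update it touches $\mathrm{stair}(p)$ together with the stair of the predecessor or of the successor of $p$, whichever makes the set of points touched at time $t$ smaller (ties are broken arbitrarily). The *cost* of Greedy on $S$ is the total number of touched points. **Theorem.** Let $S$ be an output-restricted deque sequence of length $m$ on $[n]$, i.e. an update sequence without accesses in which every insertion is at the current minimum or maximum and every deletion is at the current minimum. Then the cost of executing $S$ by Greedy is at most $24m+12n$. -/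

import Mathlib

namespace GreedyBST

/-- The three kinds of operations on a dictionary. -/
inductive Op where
  | access
  | insert
  | delete
  deriving DecidableEq

/-- A sequence of `m` operations on keys from an `n`-element ordered universe `[n]`:
at time `t` the operation `(S t).2` is applied to the key `(S t).1`. -/
abbrev OpSeq (n m : ℕ) := Fin m → Fin n × Op

/-- Points of the integer grid `[n] × [m]`: (key, time). Later rows are drawn higher. -/
abbrev Pt (n m : ℕ) := Fin n × Fin m

variable {n m : ℕ}

/-- Insertion points `I(S)`. -/
def insPts (S : OpSeq n m) : Set (Pt n m) := {p | S p.2 = (p.1, Op.insert)}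

/-- Deletion points `D(S)`. -/
def delPts (S : OpSeq n m) : Set (Pt n m) := {p | S p.2 = (p.1, Op.delete)}

/-- Update points `U(S)`. -/
def updPts (S : OpSeq n m) : Set (Pt n m) := insPts S ∪ delPts S

/-- `q` is the update point nearest to `p` below `p` (same key, earlier time). -/
def IsPrevUpd (S : OpSeq n m) (p q : Pt n m) : Prop :=
  q ∈ updPts S ∧ q.1 = p.1 ∧ q.2 < p.2 ∧ ∀ t, q.2 < t → t < p.2 → (p.1, t) ∉ updPts S

/-- `q` is the update point nearest to `p` above `p` (same key, later time). -/
def IsNextUpd (S : OpSeq n m) (p q : Pt n m) : Prop :=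
  q ∈ updPts S ∧ q.1 = p.1 ∧ p.2 < q.2 ∧ ∀ t, p.2 < t → t < q.2 → (p.1, t) ∉ updPts S

/-- `p` is a valid point: the key `p.1` can be touched at time `p.2`. A key whose first update is
a deletion, or which is never updated, is implicitly in the initial tree. -/
def Valid (S : OpSeq n m) (p : Pt n m) : Prop :=
  (p ∉ updPts S ∧ (∀ q, IsPrevUpd S p q → q ∈ insPts S) ∧ (∀ q, IsNextUpd S p q → q ∈ delPts S)) ∨
  (p ∈ insPts S ∧ (∀ q, IsPrevUpd S p q → q ∈ delPts S) ∧ (∀ q, IsNextUpd S p q → q ∈ delPts S)) ∨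
  (p ∈ delPts S ∧ (∀ q, IsPrevUpd S p q → q ∈ insPts S) ∧ (∀ q, IsNextUpd S p q → q ∈ insPts S))

/-- `S` is an update sequence: each of its points is valid. For the updates this says that
insertions and deletions of the same key alternate; for the accesses, that the accessed key is
present. -/
def IsUpdateSeq (S : OpSeq n m) : Prop := ∀ t, Valid S ((S t).1, t)

/-- No key smaller than `p.1` is present at time `p.2`, i.e. `p` has no predecessor. -/
def IsMinPt (S : OpSeq n m) (p : Pt n m) : Prop := ∀ y, y < p.1 → ¬ Valid S (y, p.2)

/-- No key larger than `p.1` is present at time `p.2`, i.e. `p` has no successor. -/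
def IsMaxPt (S : OpSeq n m) (p : Pt n m) : Prop := ∀ y, p.1 < y → ¬ Valid S (y, p.2)

/-- Deque sequence: no accesses, all insertions and deletions at the current minimum or maximum. -/
def IsDeque (S : OpSeq n m) : Prop :=
  IsUpdateSeq S ∧ ∀ t, (S t).2 ≠ Op.access ∧ (IsMinPt S ((S t).1, t) ∨ IsMaxPt S ((S t).1, t))

/-- Output-restricted deque sequence: deletions only at the current minimum. -/
def IsOutputRestricted (S : OpSeq n m) : Prop :=
  IsDeque S ∧ ∀ t, (S t).2 = Op.delete → IsMinPt S ((S t).1, t)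

/-- The key `x` is active from time `s` to time `t`: the whole interval `[s, t]` lies in one
active period of `x`, which starts with an insertion of `x` (or at the beginning) and
ends with the next deletion of `x` (or at the end). The conditions on `delPts` and `insPts`
separate two active periods that are adjacent in time. -/
def ActiveFromTo (S : OpSeq n m) (x : Fin n) (s t : Fin m) : Prop :=
  ∀ r, s ≤ r → r ≤ t →
    Valid S (x, r) ∧ (r < t → (x, r) ∉ delPts S) ∧ (s < r → (x, r) ∉ insPts S)

/-- `p` and `q`, with `q` below `p`, form an active pair: both are active from `q.2` to `p.2`. -/
def ActivePair (S : OpSeq n m) (p q : Pt n m) : Prop :=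
  ActiveFromTo S p.1 q.2 p.2 ∧ ActiveFromTo S q.1 q.2 p.2

/-- The closed rectangle spanned by `p` and `q` (`q` below `p`) is satisfied by `P`: it contains a
point of `P` other than `p`, `q`, where on the bottommost row a deletion point does not count and
on the topmost row an insertion point does not count. -/
def RectSat (S : OpSeq n m) (P : Finset (Pt n m)) (p q : Pt n m) : Prop :=
  ∃ r ∈ P, r ∈ Set.uIcc p q ∧ r ≠ p ∧ r ≠ q ∧
    (r.2 = q.2 → r ∉ delPts S) ∧ (r.2 = p.2 → r ∉ insPts S)

open Classical in
/-- The stair of `p` with respect to the set `P` of points touched so far. -/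
noncomputable def stair (S : OpSeq n m) (P : Finset (Pt n m)) (p : Pt n m) : Finset (Pt n m) :=
  {p} ∪ P.filter (fun q => q.2 < p.2 ∧ ActivePair S p q ∧ ¬ RectSat S P p q)

/-- The points added to the row of `p` when the stair of `p` is touched. -/
noncomputable def touchStair (S : OpSeq n m) (P : Finset (Pt n m)) (p : Pt n m) :
    Finset (Pt n m) :=
  (stair S P p).image (fun q => (q.1, p.2))

open Classical in
/-- Keys below `p.1` that are present at time `p.2`; the maximum is the predecessor of `p`. -/
noncomputable def predKeys (S : OpSeq n m) (p : Pt n m) : Finset (Fin n) :=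
  Finset.univ.filter (fun y => y < p.1 ∧ Valid S (y, p.2))

open Classical in
/-- Keys above `p.1` that are present at time `p.2`; the minimum is the successor of `p`. -/
noncomputable def succKeys (S : OpSeq n m) (p : Pt n m) : Finset (Fin n) :=
  Finset.univ.filter (fun y => p.1 < y ∧ Valid S (y, p.2))

open Classical in
/-- The points touched by Greedy at time `t`, if `P` is the set of points touched before time `t`.
For an access, or an update at the minimum or maximum, Greedy touches the stair of the input point;
for any other update it touches in addition the stair of the predecessor or of the successor,
whichever makes the touched set smaller. `tie t` says which one is taken if both sets have
the same size (`true` for the predecessor). -/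
noncomputable def greedyRow (S : OpSeq n m) (tie : Fin m → Bool) (P : Finset (Pt n m))
    (t : Fin m) : Finset (Pt n m) :=
  let p : Pt n m := ((S t).1, t)
  if h : p ∈ updPts S ∧ (predKeys S p).Nonempty ∧ (succKeys S p).Nonempty then
    let A := touchStair S P p ∪ touchStair S P ((predKeys S p).max' h.2.1, t)
    let B := touchStair S P p ∪ touchStair S P ((succKeys S p).min' h.2.2, t)
    if A.card < B.card ∨ (A.card = B.card ∧ tie t = true) then A else B
  else touchStair S P p

/-- The points touched by Greedy in the first `k` time steps. -/
noncomputable def greedyUpTo (S : OpSeq n m) (tie : Fin m → Bool) : ℕ → Finset (Pt n m)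
  | 0 => ∅
  | k + 1 =>
    if h : k < m then
      greedyUpTo S tie k ∪ greedyRow S tie (greedyUpTo S tie k) ⟨k, h⟩
    else greedyUpTo S tie k

/-- The cost of executing `S` by (online geometric) Greedy: the number of touched points. -/
noncomputable def greedyCost (S : OpSeq n m) (tie : Fin m → Bool) : ℕ :=
  (greedyUpTo S tie m).card

end GreedyBST

/-! Greedy adds nothing beyond the input in a row of insertion, because an active pair never crosses
an insertion. In a row of deletion the input is the current minimum, and the stair rises to its
right. Every touch of another key descends through earlier touches of its active period to an
insertion. Initial active periods are therefore touched only at their deletion, which is why the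
bound proved, `5 * m`, has no term in `n`.

The engine is `not_mem_of_touched_smaller`: once `z` is touched, it shields the larger keys for as
long as it stays present. To use it, time is cut into epochs, and each touch other than an input is
called old or new according to whether its key was inserted before or during the epoch. Old keys
coexist from the start of the epoch, so only the first old touch of an active period can fail to be
the largest in its row. A new touched key outlives its epoch (`active_of_epoch`), so within the
epoch it shields larger keys; hence only the last new touch of an active period can fail to be the
smallest in its row. Charging extremal touches to rows and the others to insertions gives `4 * m`;
the inputs add `m`. -/

namespace GreedyBST

/-! ### Presence of keys and active periods -/

section Validity

variable {n m : ℕ} {S : OpSeq n m}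

lemma not_mem_insPts_of_mem_delPts {p : Pt n m} (h : p ∈ delPts S) : p ∉ insPts S := by
  intro h'
  have h1 : S p.2 = (p.1, Op.delete) := h
  have h2 : S p.2 = (p.1, Op.insert) := h'
  rw [h1] at h2
  simp at h2

lemma valid_of_mem_updPts (hS : IsUpdateSeq S) {p : Pt n m} (h : p ∈ updPts S) : Valid S p := by
  have hk : (S p.2).1 = p.1 := by
    rcases h with h | h
    · have h1 : S p.2 = (p.1, Op.insert) := h
      rw [h1]
    · have h1 : S p.2 = (p.1, Op.delete) := h
      rw [h1]
  have := hS p.2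
  rwa [hk] at this

/-- A key that is present and not deleted stays present. -/
lemma Valid.succ (hS : IsUpdateSeq S) {x : Fin n} {r r' : Fin m} (hr : r'.val = r.val + 1)
    (hv : Valid S (x, r)) (hd : (x, r) ∉ delPts S) :
    Valid S (x, r') ∧ (x, r') ∉ insPts S := by
  have hlt : r < r' := by rw [Fin.lt_def]; omega
  have hnext : ∀ q, IsNextUpd S (x, r) q → q ∈ delPts S := by
    rcases hv with h | h | h
    · exact h.2.2
    · exact h.2.2
    · exact absurd h.1 hd
  by_cases hu : (x, r') ∈ updPts S
  · have : (x, r') ∈ delPts S := by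
      refine hnext _ ⟨hu, rfl, hlt, fun t h1 h2 => ?_⟩
      simp only [Fin.lt_def] at h1 h2
      omega
    exact ⟨valid_of_mem_updPts hS hu, not_mem_insPts_of_mem_delPts this⟩
  · refine ⟨Or.inl ⟨hu, ?_, ?_⟩, fun h => hu (Or.inl h)⟩
    · rintro ⟨y, s⟩ ⟨hq, rfl, hs, hb⟩
      simp only [Fin.lt_def] at hs
      by_cases hsr : s = r
      · subst hsr
        exact hq.resolve_right hd
      · have hsr' : s < r := by
          rw [Fin.lt_def]
          have : s.val ≠ r.val := fun h => hsr (Fin.ext h)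
          omega
        have hru : (y, r) ∉ updPts S := hb r hsr' hlt
        rcases hv with h | h | h
        · exact h.2.1 _ ⟨hq, rfl, hsr', fun t h1 h2 => hb t h1 (h2.trans hlt)⟩
        · exact absurd (Or.inl h.1) hru
        · exact absurd (Or.inr h.1) hru
    · rintro ⟨y, s⟩ ⟨hq, rfl, hs, hb⟩
      refine hnext _ ⟨hq, rfl, hlt.trans hs, fun t h1 h2 => ?_⟩
      by_cases htr : t = r'
      · rwa [htr]
      · refine hb t ?_ h2
        have : t.val ≠ r'.val := fun h => htr (Fin.ext h)
        simp only [Fin.lt_def] at h1 ⊢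
        omega

/-- A key that is present and not being inserted was present before. -/
lemma Valid.pred (hS : IsUpdateSeq S) {x : Fin n} {r r' : Fin m} (hr : r'.val = r.val + 1)
    (hv : Valid S (x, r')) (hd : (x, r') ∉ insPts S) :
    Valid S (x, r) ∧ (x, r) ∉ delPts S := by
  have hlt : r < r' := by rw [Fin.lt_def]; omega
  have hprev : ∀ q, IsPrevUpd S (x, r') q → q ∈ insPts S := by
    rcases hv with h | h | h
    · exact h.2.1
    · exact absurd h.1 hd
    · exact h.2.1
  by_cases hu : (x, r) ∈ updPts S
  · have : (x, r) ∈ insPts S := by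
      refine hprev _ ⟨hu, rfl, hlt, fun t h1 h2 => ?_⟩
      simp only [Fin.lt_def] at h1 h2
      omega
    exact ⟨valid_of_mem_updPts hS hu, fun h => not_mem_insPts_of_mem_delPts h this⟩
  · refine ⟨Or.inl ⟨hu, ?_, ?_⟩, fun h => hu (Or.inr h)⟩
    · rintro ⟨y, s⟩ ⟨hq, rfl, hs, hb⟩
      refine hprev _ ⟨hq, rfl, hs.trans hlt, fun t h1 h2 => ?_⟩
      by_cases htr : t = r
      · rwa [htr]
      · refine hb t h1 ?_
        have : t.val ≠ r.val := fun h => htr (Fin.ext h)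
        simp only [Fin.lt_def] at h2 ⊢
        omega
    · rintro ⟨y, s⟩ ⟨hq, rfl, hs, hb⟩
      simp only [Fin.lt_def] at hs
      by_cases hsr : s = r'
      · subst hsr
        exact hq.resolve_left hd
      · have hsr' : r' < s := by
          rw [Fin.lt_def]
          have : s.val ≠ r'.val := fun h => hsr (Fin.ext h)
          omega
        have hru : (y, r') ∉ updPts S := hb r' hlt hsr'
        rcases hv with h | h | h
        · exact h.2.2 _ ⟨hq, rfl, hsr', fun t h1 h2 => hb t (hlt.trans h1) h2⟩
        · exact absurd (Or.inl h.1) hru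
        · exact absurd (Or.inr h.1) hru

lemma ActiveFromTo.mono {x : Fin n} {s s' t t' : Fin m} (h : ActiveFromTo S x s t) (hs : s ≤ s')
    (ht : t' ≤ t) : ActiveFromTo S x s' t' := fun r h1 h2 =>
  ⟨(h r (hs.trans h1) (h2.trans ht)).1,
    fun h3 => (h r (hs.trans h1) (h2.trans ht)).2.1 (h3.trans_le ht),
    fun h3 => (h r (hs.trans h1) (h2.trans ht)).2.2 (hs.trans_lt h3)⟩

lemma ActiveFromTo.trans {x : Fin n} {s t u : Fin m} (h₁ : ActiveFromTo S x s t)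
    (h₂ : ActiveFromTo S x t u) (hst : s < t) (htu : t < u) : ActiveFromTo S x s u := by
  intro r h1 h2
  rcases lt_trichotomy r t with h | h | h
  · exact ⟨(h₁ r h1 h.le).1, fun _ => (h₁ r h1 h.le).2.1 h, (h₁ r h1 h.le).2.2⟩
  · subst h
    exact ⟨(h₁ r h1 le_rfl).1, (h₂ r le_rfl h2).2.1, (h₁ r h1 le_rfl).2.2⟩
  · exact ⟨(h₂ r h.le h2).1, (h₂ r h.le h2).2.1, fun _ => (h₂ r h.le h2).2.2 h⟩

lemma activeFromTo_self {x : Fin n} {t : Fin m} (h : Valid S (x, t)) : ActiveFromTo S x t t := by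
  intro r h1 h2
  obtain rfl := le_antisymm h1 h2
  exact ⟨h, fun h3 => absurd h3 (lt_irrefl _), fun h3 => absurd h3 (lt_irrefl _)⟩

lemma activeFromTo_of_succ {x : Fin n} {r r' : Fin m} (hr : r'.val = r.val + 1)
    (h1 : Valid S (x, r)) (h2 : (x, r) ∉ delPts S) (h3 : Valid S (x, r'))
    (h4 : (x, r') ∉ insPts S) : ActiveFromTo S x r r' := by
  intro u hu hu'
  have : u = r ∨ u = r' := by
    simp only [Fin.le_def] at hu hu'
    simp only [Fin.ext_iff]
    omega
  rcases this with rfl | rfl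
  · exact ⟨h1, fun _ => h2, fun h => absurd h (lt_irrefl _)⟩
  · exact ⟨h3, fun h => absurd h (lt_irrefl _), fun _ => h4⟩

/-- A key present at time `t` has been present since time `a`, or was inserted after time `a`. -/
lemma activeFromTo_or_exists_insert (hS : IsUpdateSeq S) {x : Fin n} {a t : Fin m} (hat : a ≤ t)
    (hv : Valid S (x, t)) :
    ActiveFromTo S x a t ∨ ∃ j, a < j ∧ j ≤ t ∧ (x, j) ∈ insPts S ∧ ActiveFromTo S x j t := by
  obtain ⟨d, hd⟩ : ∃ d, d = t.val - a.val := ⟨_, rfl⟩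
  induction d generalizing a with
  | zero =>
    have : a = t := Fin.ext (by rw [Fin.le_def] at hat; omega)
    subst this
    exact Or.inl (activeFromTo_self hv)
  | succ d ih =>
    rw [Fin.le_def] at hat
    let a' : Fin m := ⟨a.val + 1, by omega⟩
    have haa' : a < a' := by rw [Fin.lt_def]; simp [a']
    rcases ih (a := a') (by rw [Fin.le_def]; simp only [a']; omega) (by simp only [a']; omega) with
      h | ⟨j, h1, h2, h3⟩
    · have hle : a' ≤ t := by rw [Fin.le_def]; simp only [a']; omega
      by_cases hi : (x, a') ∈ insPts S
      · exact Or.inr ⟨a', haa', hle, hi, h⟩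
      · have hva := (h a' le_rfl hle).1
        obtain ⟨h1, h2⟩ := Valid.pred hS (r := a) rfl hva hi
        have hact : ActiveFromTo S x a a' := activeFromTo_of_succ rfl h1 h2 hva hi
        rcases hle.eq_or_lt with he | hlt
        · left
          rwa [he] at hact
        · exact Or.inl (hact.trans h haa' hlt)
    · exact Or.inr ⟨j, haa'.trans h1, h2, h3⟩

/-- A key present at time `t` is present until time `b`, or is deleted before time `b`. -/
lemma activeFromTo_or_exists_delete (hS : IsUpdateSeq S) {x : Fin n} {t b : Fin m} (htb : t ≤ b)
    (hv : Valid S (x, t)) :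
    ActiveFromTo S x t b ∨ ∃ u, t ≤ u ∧ u < b ∧ (x, u) ∈ delPts S ∧ ActiveFromTo S x t u := by
  obtain ⟨d, hd⟩ : ∃ d, d = b.val - t.val := ⟨_, rfl⟩
  induction d generalizing b with
  | zero =>
    have : b = t := Fin.ext (by rw [Fin.le_def] at htb; omega)
    subst this
    exact Or.inl (activeFromTo_self hv)
  | succ d ih =>
    rw [Fin.le_def] at htb
    let b' : Fin m := ⟨b.val - 1, by omega⟩
    have hbb' : b.val = b'.val + 1 := by simp only [b']; omega
    have hlt : b' < b := by rw [Fin.lt_def]; omega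
    rcases ih (b := b') (by rw [Fin.le_def]; omega) (by omega) with h | ⟨u, h1, h2, h3⟩
    · have hle : t ≤ b' := by rw [Fin.le_def]; omega
      by_cases hi : (x, b') ∈ delPts S
      · exact Or.inr ⟨b', hle, hlt, hi, h⟩
      · have hva := (h b' hle le_rfl).1
        obtain ⟨h1, h2⟩ := Valid.succ hS hbb' hva hi
        have hact : ActiveFromTo S x b' b := activeFromTo_of_succ hbb' hva hi h1 h2
        rcases hle.eq_or_lt with he | hlt'
        · left
          rwa [← he] at hact
        · exact Or.inl (h.trans hact hlt' hlt)
    · exact Or.inr ⟨u, h1, h2.trans hlt, h3⟩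

end Validity

/-! ### Shape of the touched rows and the shielding property -/

section Rows

variable {n m : ℕ} {S : OpSeq n m} {tie : Fin m → Bool}

/-- An extremal update lacks a neighbour on one side, so the branch with the tie rule never occurs.
-/
lemma greedyRow_eq_touchStair (hS : IsDeque S) (P : Finset (Pt n m)) (t : Fin m) :
    greedyRow S tie P t = touchStair S P ((S t).1, t) := by
  unfold greedyRow
  rw [dif_neg]
  rintro ⟨-, ⟨y, hy⟩, ⟨z, hz⟩⟩
  simp only [predKeys, succKeys, Finset.mem_filter, Finset.mem_univ, true_and] at hy hz
  rcases (hS.2 t).2 with h | h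
  · exact h y hy.1 hy.2
  · exact h z hz.1 hz.2

lemma mem_greedyUpTo_iff (hS : IsDeque S) {k : ℕ} (hk : k ≤ m) {y : Fin n} {t : Fin m} :
    (y, t) ∈ greedyUpTo S tie k ↔
      t.val < k ∧ (y, t) ∈ touchStair S (greedyUpTo S tie t.val) ((S t).1, t) := by
  induction k with
  | zero => simp [greedyUpTo]
  | succ k ih =>
    have hk' : k < m := hk
    rw [greedyUpTo, dif_pos hk', Finset.mem_union, ih hk'.le, greedyRow_eq_touchStair hS]
    constructor
    · rintro (h | h)
      · exact ⟨h.1.trans (Nat.lt_succ_self k), h.2⟩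
      · have ht : t = ⟨k, hk'⟩ := by
          simp only [touchStair, Finset.mem_image, Prod.mk.injEq] at h
          obtain ⟨-, -, -, h⟩ := h
          exact h.symm
        subst ht
        exact ⟨Nat.lt_succ_self k, h⟩
    · rintro ⟨h1, h2⟩
      rcases Nat.lt_succ_iff_lt_or_eq.1 h1 with h | h
      · exact Or.inl ⟨h, h2⟩
      · right
        obtain rfl : t = ⟨k, hk'⟩ := Fin.ext h
        exact h2

lemma mem_greedyUpTo_of_lt (hS : IsDeque S) {y : Fin n} {s t : Fin m}
    (h : (y, s) ∈ greedyUpTo S tie m) (hst : s < t) : (y, s) ∈ greedyUpTo S tie t.val :=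
  (mem_greedyUpTo_iff hS t.isLt.le).2 ⟨hst, ((mem_greedyUpTo_iff hS le_rfl).1 h).2⟩

lemma input_mem_greedyUpTo (hS : IsDeque S) (t : Fin m) :
    ((S t).1, t) ∈ greedyUpTo S tie m := by
  rw [mem_greedyUpTo_iff hS le_rfl]
  exact ⟨t.isLt, Finset.mem_image.2 ⟨((S t).1, t), by simp [stair], rfl⟩⟩

/-- A touched point other than the input point lies in the row of a deletion, above an
earlier touched point of the same active period. -/
lemma exists_stair_of_mem (hS : IsOutputRestricted S) {y : Fin n} {t : Fin m}
    (h : (y, t) ∈ greedyUpTo S tie m) (hy : y ≠ (S t).1) :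
    ((S t).1, t) ∈ delPts S ∧ (S t).1 < y ∧ ∃ s < t, (y, s) ∈ greedyUpTo S tie m ∧
      ActiveFromTo S (S t).1 s t ∧ ActiveFromTo S y s t ∧
      ¬ RectSat S (greedyUpTo S tie t.val) ((S t).1, t) (y, s) := by
  classical
  have h' := ((mem_greedyUpTo_iff hS.1 le_rfl).1 h).2
  obtain ⟨⟨z, s⟩, h1, h2⟩ := Finset.mem_image.1 h'
  simp only [Prod.mk.injEq] at h2
  obtain ⟨rfl, -⟩ := h2
  rcases Finset.mem_union.1 h1 with h1 | h1
  · exact absurd (congrArg Prod.fst (Finset.mem_singleton.1 h1)) hy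
  · obtain ⟨hP, hlt, ⟨hx, hz⟩, hsat⟩ := Finset.mem_filter.1 h1
    -- An insertion at `t` would start a new active period, so no earlier point could be paired with
    -- the input.
    have hop : (S t).2 = Op.delete := by
      have h1 := (hS.1.2 t).1
      have h2 : ((S t).1, t) ∉ insPts S := (hx t hlt.le le_rfl).2.2 hlt
      rcases hop : (S t).2 with _ | _ | _
      · exact absurd hop h1
      · exact (h2 (Prod.ext rfl hop)).elim
      · rfl
    refine ⟨Prod.ext rfl hop, ?_, s, hlt, ?_, hx, hz, hsat⟩
    · rcases lt_or_ge z (S t).1 with h3 | h3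
      · exact absurd (hz t hlt.le le_rfl).1 (hS.2 t hop z h3)
      · exact lt_of_le_of_ne h3 hy.symm
    · rw [mem_greedyUpTo_iff hS.1 t.isLt.le] at hP
      exact (mem_greedyUpTo_iff hS.1 le_rfl).2 ⟨s.isLt, hP.2⟩

lemma ne_input_of_active {y : Fin n} {a s t : Fin m} (hS : IsDeque S)
    (h : ActiveFromTo S y a t) (has : a < s) (hst : s < t) : y ≠ (S s).1 := by
  rintro rfl
  obtain ⟨-, h1, h2⟩ := h s has.le hst.le
  rcases hop : (S s).2 with _ | _ | _
  · exact (hS.2 s).1 hop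
  · exact h2 has (Prod.ext rfl hop)
  · exact h1 hst (Prod.ext rfl hop)

/-- The active period of a key touched in the row of another key starts with an insertion. -/
lemma exists_insert_of_mem (hS : IsOutputRestricted S) {y : Fin n} {t : Fin m}
    (h : (y, t) ∈ greedyUpTo S tie m) (hy : y ≠ (S t).1) :
    ∃ i < t, (y, i) ∈ insPts S ∧ ActiveFromTo S y i t := by
  induction t using WellFoundedLT.induction with
  | ind t ih =>
    obtain ⟨-, -, s, hst, hs, -, hact, -⟩ := exists_stair_of_mem hS h hy
    -- The descent ends at an input row of `y`; this is no deletion, since the active period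
    -- continues past `s`.
    by_cases hys : y = (S s).1
    · refine ⟨s, hst, ?_, hact⟩
      subst hys
      rcases hop : (S s).2 with _ | _ | _
      · exact absurd hop (hS.1.2 s).1
      · exact Prod.ext rfl hop
      · exact ((hact s le_rfl hst.le).2.1 hst (Prod.ext rfl hop)).elim
    · obtain ⟨i, his, hi, hact'⟩ := ih s hst hs hys
      exact ⟨i, his.trans hst, hi, hact'.trans hact his hst⟩

/-- Once a key is touched, the larger keys present at that time are not touched any more
until it is deleted. -/
lemma not_mem_of_touched_smaller (hS : IsOutputRestricted S) {z y : Fin n} {s t : Fin m}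
    (hzy : z < y) (hz : (z, s) ∈ greedyUpTo S tie m) (hst : s < t)
    (haz : ActiveFromTo S z s t) (hay : ActiveFromTo S y s t) (hy : y ≠ (S t).1) :
    (y, t) ∉ greedyUpTo S tie m := by
  induction t using WellFoundedLT.induction with
  | ind t ih =>
    intro h
    obtain ⟨hdel, -, s', hst', hs', -, -, hsat⟩ := exists_stair_of_mem hS h hy
    -- Since the deleted key is the minimum, it is at most `z`. If `s' ≤ s`, the point `(z, s)` thus
    -- satisfies the rectangle; otherwise the claim already fails at the earlier time `s'`.
    rcases le_or_gt s' s with hle | hlt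
    · have hxz : (S t).1 ≤ z := by
        by_contra hlt
        exact hS.2 t (congrArg Prod.snd (hdel : S t = ((S t).1, Op.delete))) z (not_le.1 hlt)
          (haz t hst.le le_rfl).1
      refine hsat ⟨(z, s), mem_greedyUpTo_of_lt hS.1 hz hst, ?_, ?_, ?_, ?_, ?_⟩
      · rw [Set.uIcc, Set.mem_Icc]
        exact ⟨⟨inf_le_left.trans hxz, inf_le_right.trans hle⟩,
          ⟨hzy.le.trans le_sup_right, hst.le.trans le_sup_left⟩⟩
      · exact fun he => hst.ne (congrArg Prod.snd he)
      · exact fun he => hzy.ne (congrArg Prod.fst he)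
      · exact fun _ => (haz s le_rfl hst.le).2.1 hst
      · exact fun he => absurd he hst.ne
    · exact ih s' hst' hlt (haz.mono le_rfl hst'.le) (hay.mono le_rfl hst'.le)
        (ne_input_of_active hS.1 hay hlt hst') hs'

end Rows

/-! ### Epochs -/

section Epochs

variable {n m : ℕ}

/-- The key `k` is present throughout `[b, t]` and was inserted before time `b`, if at all. -/
def PresentSince (S : OpSeq n m) (k : Fin n) (b : ℕ) (t : ℕ) : Prop :=
  ∀ r : Fin m, b ≤ r.val → r.val ≤ t →
    Valid S (k, r) ∧ (k, r) ∉ insPts S ∧ (r.val < t → (k, r) ∉ delPts S)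

open Classical in
/-- The start of the epoch containing time `t`: an epoch ends when all keys present at its start
have been deleted. -/
noncomputable def epochStart (S : OpSeq n m) : ℕ → ℕ
  | 0 => 0
  -- The witness may be deleted at `t + 1` itself, so the row deleting the last initial key still
  -- belongs to the epoch.
  | t + 1 => if ∃ k, PresentSince S k (epochStart S t) (t + 1) then epochStart S t else t + 1

variable {S : OpSeq n m} {tie : Fin m → Bool}

lemma PresentSince.mono {k : Fin n} {b t t' : ℕ} (h : PresentSince S k b t) (ht : t' ≤ t) :
    PresentSince S k b t' := fun r h1 h2 =>
  ⟨(h r h1 (h2.trans ht)).1, (h r h1 (h2.trans ht)).2.1,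
    fun h3 => (h r h1 (h2.trans ht)).2.2 (h3.trans_le ht)⟩

lemma presentSince_of_active {k : Fin n} {b : ℕ} {i t : Fin m} (h : ActiveFromTo S k i t)
    (hi : i.val < b) : PresentSince S k b t.val := fun r h1 h2 =>
  have hir : i < r := hi.trans_le h1
  ⟨(h r hir.le h2).1, (h r hir.le h2).2.2 hir, (h r hir.le h2).2.1⟩

lemma epochStart_le (t : ℕ) : epochStart S t ≤ t := by
  induction t with
  | zero => simp [epochStart]
  | succ t ih =>
    rw [epochStart]
    split_ifs
    · omega
    · exact le_rfl

lemma epochStart_mono : Monotone (epochStart S) := by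
  refine monotone_nat_of_le_succ fun t => ?_
  rw [epochStart]
  split_ifs
  · exact le_rfl
  · exact (epochStart_le t).trans t.le_succ

lemma epochStart_eq_of_le {t t' : ℕ} (htt' : t ≤ t') (h : epochStart S t' ≤ t) :
    epochStart S t' = epochStart S t := by
  induction t', htt' using Nat.le_induction with
  | base => rfl
  | succ u hu ih =>
    rw [epochStart] at h ⊢
    split_ifs at h ⊢
    · exact ih h
    · omega

lemma epochStart_eq_of_presentSince {k : Fin n} {t t' : ℕ} (htt' : t ≤ t')
    (h : PresentSince S k (epochStart S t) t') : epochStart S t' = epochStart S t := by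
  induction t', htt' using Nat.le_induction with
  | base => rfl
  | succ u hu ih =>
    have := ih (h.mono u.le_succ)
    rw [epochStart, this, if_pos ⟨k, h⟩]

/-- At the time of a deletion some key from the start of the epoch is still present. -/
lemma exists_presentSince {t : Fin m} {x : Fin n} (hS : IsUpdateSeq S)
    (h : (x, t) ∈ delPts S) : ∃ k, PresentSince S k (epochStart S t.val) t.val := by
  -- If the epoch starts at `t`, the key being deleted is itself the witness.
  have hx : PresentSince S x t.val t.val := by
    intro r h1 h2
    obtain rfl : r = t := Fin.ext (le_antisymm h2 h1)
    exact ⟨valid_of_mem_updPts hS (Or.inr h), not_mem_insPts_of_mem_delPts h,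
      fun h3 => absurd h3 (lt_irrefl _)⟩
  rcases ht : t.val with _ | u
  · rw [ht] at hx
    exact ⟨x, hx⟩
  · rw [epochStart]
    split_ifs with h1
    · exact h1
    · rw [ht] at hx
      exact ⟨x, hx⟩

/-- A key inserted in the current epoch and touched in the row of another key is not deleted
in this epoch. -/
lemma active_of_epoch (hS : IsOutputRestricted S) {z : Fin n} {i t t' : Fin m}
    (hz : (z, t) ∈ greedyUpTo S tie m) (hzt : z ≠ (S t).1) (hi : (z, i) ∈ insPts S)
    (hit : i < t) (hact : ActiveFromTo S z i t) (hei : epochStart S t.val ≤ i.val)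
    (htt' : t ≤ t') (he : epochStart S t'.val = epochStart S t.val) :
    ActiveFromTo S z t t' := by
  rcases activeFromTo_or_exists_delete hS.1.1 htt' (hact t hit.le le_rfl).1 with
    h | ⟨u, htu, hut', hu, -⟩
  · exact h
  exfalso
  have heu : epochStart S u.val = epochStart S t.val :=
    le_antisymm ((epochStart_mono (Fin.le_def.1 hut'.le)).trans he.le)
      (epochStart_mono (Fin.le_def.1 htu))
  obtain ⟨k, hk⟩ := exists_presentSince hS.1.1 hu
  rw [heu] at hk
  have hiu : i ≤ u := hit.le.trans htu
  obtain ⟨hki, hki', -⟩ := hk i hei hiu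
  have hku := (hk u (hei.trans hiu) le_rfl).1
  have hSi : S i = (z, Op.insert) := hi
  have hSu : S u = (z, Op.delete) := hu
  -- `z` is the minimum when deleted at `u`, and `k ≠ z` because `k` is not inserted at `i`. As `k`
  -- is already present above `z` at time `i`, the insertion of `z` must be at the minimum.
  have hzk : z < k := by
    rcases lt_trichotomy k z with h | h | h
    · have hmin := hS.2 u (by rw [hSu])
      rw [hSu] at hmin
      exact absurd hku (hmin k h)
    · exact absurd hi (h ▸ hki')
    · exact h
  have hmin : IsMinPt S (z, i) := by
    have := (hS.1.2 i).2
    rw [hSi] at this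
    exact this.resolve_right fun h => h k hzk hki
  obtain ⟨hdel, hxz, s, hst, -, hxact, -, -⟩ := exists_stair_of_mem hS hz hzt
  -- The key deleted at `t` is below `z`, hence was absent at time `i`. It was inserted later, and
  -- that touch shields `z` at `t`.
  rcases activeFromTo_or_exists_insert hS.1.1 hit.le (hxact t hst.le le_rfl).1 with
    h | ⟨j, hij, hjt, hj, hxj⟩
  · exact hmin _ hxz (h i le_rfl hit.le).1
  · have hjt' : j < t := by
      refine lt_of_le_of_ne hjt fun h => ?_
      subst h
      exact not_mem_insPts_of_mem_delPts hdel hj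
    have hjmem : ((S t).1, j) ∈ greedyUpTo S tie m := by
      have h1 : S j = ((S t).1, Op.insert) := hj
      have h2 := input_mem_greedyUpTo (tie := tie) hS.1 j
      rwa [h1] at h2
    exact not_mem_of_touched_smaller hS hxz hjmem hjt' hxj (hact.mono hij.le le_rfl) hzt hz

end Epochs

/-! ### Charging touches to rows and insertions -/

section Counting

variable {n m : ℕ} {S : OpSeq n m} {tie : Fin m → Bool}

/-- `i` is the time of the insertion that starts the active period in which the key of `q`,
which is not the input key, is touched. -/
def InsertedAt (S : OpSeq n m) (tie : Fin m → Bool) (q : Pt n m) (i : Fin m) : Prop :=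
  q ∈ greedyUpTo S tie m ∧ q.1 ≠ (S q.2).1 ∧ i < q.2 ∧ (q.1, i) ∈ insPts S ∧
    ActiveFromTo S q.1 i q.2

/-- `q` is touched in the row of another key, and its key was inserted before the current epoch. -/
def IsOld (S : OpSeq n m) (tie : Fin m → Bool) (q : Pt n m) : Prop :=
  ∃ i, InsertedAt S tie q i ∧ i.val < epochStart S q.2.val

/-- `q` is touched in the row of another key, and its key was inserted in the current epoch. -/
def IsNew (S : OpSeq n m) (tie : Fin m → Bool) (q : Pt n m) : Prop :=
  ∃ i, InsertedAt S tie q i ∧ epochStart S q.2.val ≤ i.val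

lemma InsertedAt.unique {q : Pt n m} {i j : Fin m} (hi : InsertedAt S tie q i)
    (hj : InsertedAt S tie q j) : i = j := by
  obtain ⟨-, -, h1, h2, h3⟩ := hi
  obtain ⟨-, -, h4, h5, h6⟩ := hj
  rcases lt_trichotomy i j with h | h | h
  · exact absurd h5 ((h3 j h.le h4.le).2.2 h)
  · exact h
  · exact absurd h2 ((h6 i h.le h1.le).2.2 h)

lemma InsertedAt.key_eq {q q' : Pt n m} {i : Fin m} (hi : InsertedAt S tie q i)
    (hj : InsertedAt S tie q' i) : q.1 = q'.1 := by
  have h1 : S i = (q.1, Op.insert) := hi.2.2.2.1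
  have h2 : S i = (q'.1, Op.insert) := hj.2.2.2.1
  exact (Prod.mk.inj (h1.symm.trans h2)).1

/-- The survival of `y` keeps `t` and `t'` in one epoch, so an old `y'` is already present at `t`
and is shielded by the touch of `y` there. -/
lemma old_not_lt (hS : IsOutputRestricted S) {y y' : Fin n} {i t t' : Fin m} (htt' : t < t')
    (h : InsertedAt S tie (y, t) i) (hold : i.val < epochStart S t.val)
    (h' : InsertedAt S tie (y, t') i) (hyy' : y < y') : ¬ IsOld S tie (y', t') := by
  rintro ⟨j, hj, hjo⟩
  have he : epochStart S t'.val = epochStart S t.val :=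
    epochStart_eq_of_presentSince (Fin.le_def.1 htt'.le) (presentSince_of_active h'.2.2.2.2 hold)
  have hjt : j ≤ t := by
    have := epochStart_le (S := S) t.val
    simp only at hjo
    rw [Fin.le_def]
    omega
  exact not_mem_of_touched_smaller hS hyy' h.1 htt' (h'.2.2.2.2.mono h.2.2.1.le le_rfl)
    (hj.2.2.2.2.mono hjt le_rfl) hj.2.1 hj.1

/-- Both times lie in one epoch, so a new `z` touched at `t` would survive until `t'` and shield `y`
there. -/
lemma new_not_lt (hS : IsOutputRestricted S) {y z : Fin n} {i t t' : Fin m} (htt' : t < t')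
    (h : InsertedAt S tie (y, t) i) (h' : InsertedAt S tie (y, t') i)
    (hnew : epochStart S t'.val ≤ i.val) (hzy : z < y) : ¬ IsNew S tie (z, t) := by
  rintro ⟨j, hj, hjn⟩
  have hit : i < t := h.2.2.1
  have he : epochStart S t'.val = epochStart S t.val :=
    epochStart_eq_of_le (Fin.le_def.1 htt'.le) (hnew.trans (Fin.le_def.1 hit.le))
  have hz := active_of_epoch hS hj.1 hj.2.1 hj.2.2.2.1 hj.2.2.1 hj.2.2.2.2 hjn htt'.le he
  exact not_mem_of_touched_smaller hS hzy hj.1 htt' hz (h'.2.2.2.2.mono hit.le le_rfl)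
    h'.2.1 h'.1

lemma card_le_of_rel_injective {Q : Finset (Pt n m)} (R : Pt n m → Fin m → Prop)
    (hR : ∀ q ∈ Q, ∃ i, R q i)
    (hinj : ∀ q ∈ Q, ∀ q' ∈ Q, ∀ i, R q i → R q' i → q = q') : Q.card ≤ m := by
  classical
  rcases Q.eq_empty_or_nonempty with rfl | ⟨p, -⟩
  · simp
  have : Nonempty (Fin m) := ⟨p.2⟩
  choose! f hf using hR
  calc Q.card ≤ (Finset.univ : Finset (Fin m)).card :=
        Finset.card_le_card_of_injOn f (fun _ _ => Finset.mem_univ _)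
          fun q hq q' hq' he => hinj q hq q' hq' (f q) (hf q hq) (he ▸ hf q' hq')
    _ = m := by simp

lemma card_nonmax_old_le (hS : IsOutputRestricted S) {Q : Finset (Pt n m)}
    (hQ : ∀ q ∈ Q, IsOld S tie q ∧ ∃ y, q.1 < y ∧ IsOld S tie (y, q.2)) : Q.card ≤ m := by
  refine card_le_of_rel_injective (InsertedAt S tie)
    (fun q hq => (hQ q hq).1.imp fun _ h => h.1) ?_
  rintro ⟨y, t⟩ hq ⟨y', t'⟩ hq' i hi hi'
  obtain rfl : y = y' := hi.key_eq hi'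
  obtain ⟨⟨j, hj, hjo⟩, z, hz, hzo⟩ := hQ _ hq
  obtain ⟨⟨j', hj', hjo'⟩, z', hz', hzo'⟩ := hQ _ hq'
  obtain rfl := hj.unique hi
  obtain rfl := hj'.unique hi'
  rcases lt_trichotomy t t' with h | h | h
  · exact absurd hzo' (old_not_lt hS h hi hjo hi' hz')
  · rw [h]
  -- Of two old touches from one insertion, the later one is the largest old touch of its row.
  · exact absurd hzo (old_not_lt hS h hi' hjo' hi hz)

lemma card_nonmin_new_le (hS : IsOutputRestricted S) {Q : Finset (Pt n m)}
    (hQ : ∀ q ∈ Q, IsNew S tie q ∧ ∃ y, y < q.1 ∧ IsNew S tie (y, q.2)) : Q.card ≤ m := by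
  refine card_le_of_rel_injective (InsertedAt S tie)
    (fun q hq => (hQ q hq).1.imp fun _ h => h.1) ?_
  rintro ⟨y, t⟩ hq ⟨y', t'⟩ hq' i hi hi'
  obtain rfl : y = y' := hi.key_eq hi'
  obtain ⟨⟨j, hj, hjo⟩, z, hz, hzo⟩ := hQ _ hq
  obtain ⟨⟨j', hj', hjo'⟩, z', hz', hzo'⟩ := hQ _ hq'
  obtain rfl := hj.unique hi
  obtain rfl := hj'.unique hi'
  rcases lt_trichotomy t t' with h | h | h
  -- Here it is the earlier touch that must be the smallest new touch of its row.
  · exact absurd hzo (new_not_lt hS h hi hi' hjo' hz)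
  · rw [h]
  · exact absurd hzo' (new_not_lt hS h hi' hi hjo hz')

lemma card_le_of_row_injective {Q : Finset (Pt n m)}
    (hQ : ∀ q ∈ Q, ∀ q' ∈ Q, q.2 = q'.2 → q.1 = q'.1) : Q.card ≤ m :=
  card_le_of_rel_injective (fun q t => q.2 = t) (fun q _ => ⟨q.2, rfl⟩)
    fun q hq q' hq' _ h h' => Prod.ext (hQ q hq q' hq' (h.trans h'.symm)) (h.trans h'.symm)

theorem greedyCost_le (hS : IsOutputRestricted S) (tie : Fin m → Bool) :
    greedyCost S tie ≤ 5 * m := by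
  classical
  let T := greedyUpTo S tie m
  let T₀ := T.filter fun q => q.1 = (S q.2).1
  let T₁ := T.filter fun q => IsOld S tie q ∧ ∀ y, IsOld S tie (y, q.2) → y ≤ q.1
  let T₂ := T.filter fun q => IsOld S tie q ∧ ∃ y, q.1 < y ∧ IsOld S tie (y, q.2)
  let T₃ := T.filter fun q => IsNew S tie q ∧ ∀ y, IsNew S tie (y, q.2) → q.1 ≤ y
  let T₄ := T.filter fun q => IsNew S tie q ∧ ∃ y, y < q.1 ∧ IsNew S tie (y, q.2)
  have h₀ : T₀.card ≤ m := card_le_of_row_injective fun q hq q' hq' h => by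
    rw [(Finset.mem_filter.1 hq).2, (Finset.mem_filter.1 hq').2, h]
  have h₁ : T₁.card ≤ m := card_le_of_row_injective fun q hq q' hq' h => by
    obtain ⟨-, h1, h2⟩ := Finset.mem_filter.1 hq
    obtain ⟨-, h3, h4⟩ := Finset.mem_filter.1 hq'
    exact le_antisymm (h4 _ (h ▸ h1)) (h2 _ (h ▸ h3))
  have h₂ : T₂.card ≤ m := card_nonmax_old_le hS fun q hq => (Finset.mem_filter.1 hq).2
  have h₃ : T₃.card ≤ m := card_le_of_row_injective fun q hq q' hq' h => by
    obtain ⟨-, h1, h2⟩ := Finset.mem_filter.1 hq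
    obtain ⟨-, h3, h4⟩ := Finset.mem_filter.1 hq'
    exact le_antisymm (h2 _ (h ▸ h3)) (h4 _ (h ▸ h1))
  have h₄ : T₄.card ≤ m := card_nonmin_new_le hS fun q hq => (Finset.mem_filter.1 hq).2
  have hT : T ⊆ T₀ ∪ T₁ ∪ T₂ ∪ T₃ ∪ T₄ := by
    intro q hq
    simp only [Finset.mem_union, T₀, T₁, T₂, T₃, T₄, Finset.mem_filter, hq, true_and]
    by_cases hself : q.1 = (S q.2).1
    · simp [hself]
    obtain ⟨i, h1, h2, h3⟩ := exists_insert_of_mem hS hq hself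
    have hi : InsertedAt S tie q i := ⟨hq, hself, h1, h2, h3⟩
    rcases lt_or_ge i.val (epochStart S q.2.val) with h | h
    · have hold : IsOld S tie q := ⟨i, hi, h⟩
      by_cases hmax : ∃ y, q.1 < y ∧ IsOld S tie (y, q.2)
      · simp [hold, hmax]
      · push Not at hmax
        exact Or.inl (Or.inl (Or.inl (Or.inr
          ⟨hold, fun y hy => not_lt.1 fun hlt => hmax y hlt hy⟩)))
    · have hnew : IsNew S tie q := ⟨i, hi, h⟩
      by_cases hmin : ∃ y, y < q.1 ∧ IsNew S tie (y, q.2)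
      · simp [hnew, hmin]
      · push Not at hmin
        exact Or.inl (Or.inr ⟨hnew, fun y hy => not_lt.1 fun hlt => hmin y hlt hy⟩)
  have hc := Finset.card_le_card hT
  have hu₁ := Finset.card_union_le (T₀ ∪ T₁ ∪ T₂ ∪ T₃) T₄
  have hu₂ := Finset.card_union_le (T₀ ∪ T₁ ∪ T₂) T₃
  have hu₃ := Finset.card_union_le (T₀ ∪ T₁) T₂
  have hu₄ := Finset.card_union_le T₀ T₁
  change T.card ≤ 5 * m
  omega

end Counting

end GreedyBST

theorem mainTheorem2 (n m : ℕ) (S : GreedyBST.OpSeq n m) (hS : GreedyBST.IsOutputRestricted S)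
    (tie : Fin m → Bool) :
    GreedyBST.greedyCost S tie ≤ 24 * m + 12 * n := by
  have := GreedyBST.greedyCost_le hS tie
  omega
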